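/- A formula $f$ is a finite list of non-empty words (its fragments) over an alphabet of variables. A morphism $h$ from words over the variables to words over an alphabet $\Sigma$ is non-erasing if the image of every variable is non-empty. An occurrence of $f$ in an infinite word $w$ over $\Sigma$ is a non-erasing morphism $h$ such that $h(\varphi)$ is a factor (a block of consecutive letters) of $w$ for every fragment $\varphi$ of $f$. The avoidability index $\lambda(f)$ is the smallest size of an alphabet $\Sigma$ such that some infinite word over $\Sigma$ contains no occurrence of $f$ ($\lambda(f)=\infty$ if there is no such finite alphabet). For $i\ge 1$, let $T_i$ be the formula with $i$ variables $A_0,\dots,A_{i-1}$ whose fragments are the $i$ words $A_jA_{j+1}A_j$ for $0\le j\le i-1$, with indices taken modulo $i$. **Theorem.** For every integer $i\ge 2$, $\lambda(T_i)=3$. -/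

import Mathlib

/-- A formula, given by its list of fragments. Variables are indexed by `ℕ`
(variable `j` is `A_j`), and a fragment is a word over the variables. -/
abbrev Formula : Type := List (FreeMonoid ℕ)

/-- A morphism of free monoids is non-erasing if the image of every letter is non-empty. -/
def NonErasing {V S : Type*} (h : FreeMonoid V →* FreeMonoid S) : Prop :=
  ∀ x : V, h (FreeMonoid.of x) ≠ 1

/-- The finite word `u` is a factor of the (right-)infinite word `w`:
for some starting position `n`, `u = w n, w (n+1), …, w (n + |u| - 1)`. -/
def IsFactorOf {S : Type*} (u : FreeMonoid S) (w : ℕ → S) : Prop :=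
  ∃ n : ℕ, u.toList = List.ofFn fun j : Fin u.length => w (n + j)

/-- `h` is an occurrence of the formula `f` in the infinite word `w`: a non-erasing morphism
such that the image of every fragment of `f` is a factor of `w`. -/
def Formula.IsOccurrence {S : Type*} (f : Formula) (w : ℕ → S)
    (h : FreeMonoid ℕ →* FreeMonoid S) : Prop :=
  NonErasing h ∧ ∀ φ ∈ f, IsFactorOf (h φ) w

/-- The infinite word `w` contains no occurrence of `f`. -/
def Formula.AvoidedBy {S : Type*} (f : Formula) (w : ℕ → S) : Prop :=
  ¬ ∃ h : FreeMonoid ℕ →* FreeMonoid S, f.IsOccurrence w h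

/-- `f` is `k`-avoidable: some infinite word over a `k`-letter alphabet avoids `f`. -/
def Formula.Avoidable (f : Formula) (k : ℕ) : Prop :=
  ∃ w : ℕ → Fin k, f.AvoidedBy w

/-- The avoidability index `λ(f)`: the least size of an alphabet over which some infinite word
avoids `f`; it is `⊤` if there is no such finite alphabet. -/
noncomputable def Formula.avoidabilityIndex (f : Formula) : ℕ∞ :=
  ⨅ (k : ℕ) (_ : f.Avoidable k), (k : ℕ∞)

/-- The circular `xyx`-formula `T_i`: variables `A_0, …, A_{i-1}` and the `i` fragments
`A_j A_{j+1} A_j`, with indices modulo `i`. -/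
def circularFormula (i : ℕ) : Formula :=
  (List.range i).map fun j => FreeMonoid.ofList [j, (j + 1) % i, j]

/-! Draw an arrow from X to Y when XYX is a factor of the infinite word. An occurrence of T_i is
then a closed walk of length i through non-empty words.

Two letters do not suffice: a finite search (`unavoidable_binaryQuadruples`) shows that every binary
word of length 23 yields closed walks of lengths two and three through a common word A.
Concatenating them gives every length i ≥ 2 (`not_avoidedBy_of_circuitPair`).

Three letters suffice: in `ternaryWord`, a factor XYX with 1 ≤ |Y| ≤ |X| forces X and Y to be single
letters with X < Y (`ternaryWord_repetition`). On a closed walk this applies to a longest word, so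
all the words are letters, and these would increase strictly around a cycle.

That property comes from a seven-letter word in which every factor XYX with X non-empty has |Y| ≥
|X| + 2 (`digitWord_no_repetition`). Long repetitions in the ternary image pull back to it; short
ones are excluded by computation. -/

/-! ### A word over seven letters with small exponent -/

/-- The weight of a digit in base eleven. -/
def digitWeight (r : ℕ) : ℕ := [0, 2, 3, 4, 5, 6, 1, 2, 3, 5, 0].getD r 0

/-- The sum modulo seven of the weights of the base-eleven digits of `n`: the fixed point of an
`11`-uniform morphism that commutes with the cyclic shift of the seven letters. -/
def digitWord (n : ℕ) : ℕ := ((Nat.digits 11 n).map digitWeight).sum % 7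

lemma digitWord_lt (n : ℕ) : digitWord n < 7 := Nat.mod_lt _ (by norm_num)

lemma digitWord_eq (n : ℕ) :
    digitWord n = (digitWord (n / 11) + digitWeight (n % 11)) % 7 := by
  rcases Nat.eq_zero_or_pos n with rfl | hn
  · decide +kernel
  · unfold digitWord
    rw [Nat.digits_def' (by norm_num) hn]
    simp only [List.map_cons, List.sum_cons]
    omega

lemma digitWord_mul_add (m r : ℕ) (hr : r < 11) :
    digitWord (11 * m + r) = (digitWord m + digitWeight r) % 7 := by
  rw [digitWord_eq, Nat.mul_add_mod, Nat.mod_eq_of_lt hr, Nat.mul_add_div (by norm_num),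
    Nat.div_eq_of_lt hr, add_zero]

lemma digitWord_succ (n : ℕ) :
    digitWord (n + 1) = (digitWord n + 1) % 7 ∨ digitWord (n + 1) = (digitWord n + 2) % 7 := by
  induction n using Nat.strong_induction_on with
  | _ n ih =>
    obtain ⟨m, r, hr, rfl⟩ : ∃ m r, r < 11 ∧ n = 11 * m + r :=
      ⟨n / 11, n % 11, Nat.mod_lt _ (by norm_num), (Nat.div_add_mod n 11).symm⟩
    rcases Nat.lt_or_ge r 10 with h | h
    · rw [add_assoc, digitWord_mul_add m r hr, digitWord_mul_add m (r + 1) (by omega)]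
      have key : ∀ r < 10, digitWeight (r + 1) % 7 = (digitWeight r + 1) % 7 ∨
          digitWeight (r + 1) % 7 = (digitWeight r + 2) % 7 := by decide
      have := key r h
      omega
    · obtain rfl : r = 10 := by omega
      have e : 11 * m + 10 + 1 = 11 * (m + 1) + 0 := by ring
      rw [e, digitWord_mul_add m 10 hr, digitWord_mul_add (m + 1) 0 (by norm_num)]
      -- The first and last weights agree, so the increment across a block boundary is that between
      -- the parent letters.
      have h0 : digitWeight 0 = 0 := rfl
      have h10 : digitWeight 10 = 0 := rfl
      have := ih m (by omega)
      omega

lemma exists_digitWord_succ (n : ℕ) :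
    ∃ d ∈ [1, 2], digitWord (n + 1) = (digitWord n + d) % 7 := by
  simpa using digitWord_succ n

/-- The word `w` has period `P` along an overlap of length `E` from position `n` on. -/
def HasRepetition {S : Type*} (w : ℕ → S) (n P E : ℕ) : Prop :=
  ∀ j < E, w (n + j) = w (n + P + j)

/-- Two consecutive blocks of length `11`, up to a shift of the letters by the first one, when the
underlying letters differ by `d`. -/
def twoBlocks (d x : ℕ) : ℕ := if x < 11 then digitWeight x else d + digitWeight (x - 11)

lemma digitWord_twoBlocks {m d : ℕ} (hd : digitWord (m + 1) = (digitWord m + d) % 7)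
    {x : ℕ} (hx : x < 22) : digitWord (11 * m + x) = (digitWord m + twoBlocks d x) % 7 := by
  unfold twoBlocks
  split_ifs with h
  · exact digitWord_mul_add m x h
  · have e : 11 * m + x = 11 * (m + 1) + (x - 11) := by omega
    rw [e, digitWord_mul_add _ _ (by omega), hd]
    omega

set_option synthInstance.maxHeartbeats 400000 in
set_option synthInstance.maxSize 1000 in
-- Increments from the start of each window are compared, with the terms crossed over to avoid
-- subtraction; the unknown parent letters thus cancel.
lemma twoBlocks_separates : ∀ d ∈ [1, 2], ∀ e ∈ [1, 2], ∀ r < 11, ∀ s < 11, r ≠ s →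
    ∃ j < 12, (twoBlocks d (r + j) + twoBlocks e s) % 7 ≠
      (twoBlocks e (s + j) + twoBlocks d r) % 7 := by
  decide +kernel

lemma digitWord_sync {n m : ℕ} (h : ∀ j < 12, digitWord (n + j) = digitWord (m + j)) :
    n % 11 = m % 11 := by
  by_contra hne
  obtain ⟨d, hd, hdn⟩ := exists_digitWord_succ (n / 11)
  obtain ⟨e, he, hem⟩ := exists_digitWord_succ (m / 11)
  obtain ⟨j, hj, hjne⟩ := twoBlocks_separates d hd e he (n % 11)
    (Nat.mod_lt _ (by norm_num)) (m % 11) (Nat.mod_lt _ (by norm_num)) hne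
  have h0 := h 0 (by norm_num)
  have h1 := h j hj
  have en : ∀ k, n + k = 11 * (n / 11) + (n % 11 + k) := by omega
  have em : ∀ k, m + k = 11 * (m / 11) + (m % 11 + k) := by omega
  rw [en, em, digitWord_twoBlocks hdn (by omega), digitWord_twoBlocks hem (by omega)] at h0 h1
  rw [add_zero, add_zero] at h0
  omega

/-- Two consecutive blocks of length `121`, up to a shift of the letters. -/
def twoLongBlocks (d x : ℕ) : ℕ :=
  if x < 121 then digitWeight (x / 11) + digitWeight (x % 11)
  else d + digitWeight ((x - 121) / 11) + digitWeight ((x - 121) % 11)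

lemma digitWord_longBlock (m x : ℕ) (hx : x < 121) : digitWord (121 * m + x) =
    (digitWord m + (digitWeight (x / 11) + digitWeight (x % 11))) % 7 := by
  have e : 121 * m + x = 11 * (11 * m + x / 11) + x % 11 := by omega
  rw [e, digitWord_mul_add _ _ (by omega), digitWord_mul_add _ _ (by omega)]
  omega

lemma digitWord_twoLongBlocks {m d : ℕ} (hd : digitWord (m + 1) = (digitWord m + d) % 7)
    {x : ℕ} (hx : x < 242) :
    digitWord (121 * m + x) = (digitWord m + twoLongBlocks d x) % 7 := by
  unfold twoLongBlocks
  split_ifs with h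
  · exact digitWord_longBlock m x h
  · have e : 121 * m + x = 121 * (m + 1) + (x - 121) := by omega
    rw [e, digitWord_longBlock _ _ (by omega), hd]
    omega

set_option synthInstance.maxHeartbeats 400000 in
set_option synthInstance.maxSize 1000 in
-- The bound on `j` is the least overlap E with E ≥ 1 and P ≤ 2E + 1.
lemma twoLongBlocks_separates : ∀ d ∈ [1, 2], ∀ r < 121, ∀ P < 24, 1 ≤ P →
    ∃ j < max 1 (P / 2), twoLongBlocks d (r + j) % 7 ≠ twoLongBlocks d (r + P + j) % 7 := by
  decide +kernel

lemma digitWord_no_short_repetition {n P E : ℕ} (hP : 1 ≤ P) (hE : 1 ≤ E) (hPE : P ≤ 2 * E + 1)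
    (hP' : P < 24) : ¬ HasRepetition digitWord n P E := by
  intro h
  obtain ⟨d, hd, hdn⟩ := exists_digitWord_succ (n / 121)
  obtain ⟨j, hj, hjne⟩ := twoLongBlocks_separates d hd (n % 121)
    (Nat.mod_lt _ (by norm_num)) P hP' hP
  have := h j (by omega)
  have en : ∀ k, n + k = 121 * (n / 121) + (n % 121 + k) := by omega
  have hr : n % 121 < 121 := Nat.mod_lt _ (by norm_num)
  rw [add_assoc n P, en, en, ← add_assoc _ P, digitWord_twoLongBlocks hdn (by omega),
    digitWord_twoLongBlocks hdn (by omega)] at this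
  omega

/-- Descent on the period: P ≥ 24 gives E ≥ 12, enough to synchronise, so 11 divides P and the
repetition lifts to the parent letters. -/
theorem digitWord_no_repetition {n P E : ℕ} (hP : 1 ≤ P) (hE : 1 ≤ E) (hPE : P ≤ 2 * E + 1) :
    ¬ HasRepetition digitWord n P E := by
  induction P using Nat.strong_induction_on generalizing n E with
  | _ P ih =>
    rcases Nat.lt_or_ge P 24 with hlt | hge
    · exact digitWord_no_short_repetition hP hE hPE hlt
    intro h
    have hs : n % 11 = (n + P) % 11 := digitWord_sync fun j hj => h j (by omega)
    obtain ⟨Q, rfl⟩ : 11 ∣ P := by omega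
    refine ih Q (by omega) (n := n / 11) (E := (n + E - 1) / 11 - n / 11 + 1) (by omega)
      (by omega) (by omega) ?_
    intro j hj
    -- One letter at a known residue determines its parent, so even blocks only partly inside the
    -- overlap count.
    obtain ⟨x, hx, hxj⟩ : ∃ x < E, (n + x) / 11 = n / 11 + j := by
      rcases Nat.eq_zero_or_pos j with rfl | hj0
      · exact ⟨0, by omega, by omega⟩
      · exact ⟨11 * (n / 11 + j) - n, by omega, by omega⟩
    have := h x hx
    have e : n + 11 * Q + x = 11 * Q + (n + x) := by ring
    rw [digitWord_eq, digitWord_eq (n + 11 * Q + x), e, Nat.mul_add_mod,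
      Nat.mul_add_div (by norm_num), hxj] at this
    have e' : Q + (n / 11 + j) = n / 11 + Q + j := by ring
    rw [e'] at this
    have h1 := digitWord_lt (n / 11 + j)
    have h2 := digitWord_lt (n / 11 + Q + j)
    omega

/-! ### A ternary word -/

/-- The images of the seven letters under a `16`-uniform morphism to three letters, each given by
the number of which it lists the base-three digits, least significant first. -/
def blockNumber (a : ℕ) : ℕ :=
  [7867970, 9285119, 9226086, 8698137, 7859463, 7630062, 7660928].getD a 0

/-- The letter with index `r` in the image of the letter `a`. -/
def ternaryBlock (a r : ℕ) : ℕ := blockNumber a / 3 ^ r % 3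

/-- The image of `digitWord` under the morphism `ternaryBlock`. -/
def ternaryNat (n : ℕ) : ℕ := ternaryBlock (digitWord (n / 16)) (n % 16)

lemma ternaryNat_mul_add (m r : ℕ) (hr : r < 16) :
    ternaryNat (16 * m + r) = ternaryBlock (digitWord m) r := by
  rw [ternaryNat, Nat.mul_add_mod, Nat.mod_eq_of_lt hr, Nat.mul_add_div (by norm_num),
    Nat.div_eq_of_lt hr, add_zero]

lemma ternaryBlock_prefix : ∀ a < 7, ∀ b < 7,
    (∀ r < 6, ternaryBlock a r = ternaryBlock b r) → a = b := by
  decide +kernel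

lemma ternaryBlock_suffix : ∀ a < 7, ∀ b < 7,
    (∀ r < 8, ternaryBlock a (8 + r) = ternaryBlock b (8 + r)) → a = b := by
  decide +kernel

/-- The number whose base-three digits form the image of the word `l`. -/
def imageNumber (l : List ℕ) : ℕ := l.foldr (fun a c => blockNumber a + 3 ^ 16 * c) 0

lemma blockNumber_lt : ∀ a < 7, blockNumber a < 3 ^ 16 := by decide +kernel

lemma imageNumber_digit (l : List ℕ) (m : ℕ)
    (hl : ∀ i (hi : i < l.length), l[i] = digitWord (m + i)) (x : ℕ) (hx : x < 16 * l.length) :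
    imageNumber l / 3 ^ x % 3 = ternaryNat (16 * m + x) := by
  induction l generalizing m x with
  | nil => simp at hx
  | cons a l ih =>
    have ha : a = digitWord m := hl 0 (Nat.succ_pos _)
    have hcons : imageNumber (a :: l) = blockNumber a + 3 ^ 16 * imageNumber l := rfl
    rw [hcons]
    rcases Nat.lt_or_ge x 16 with h | h
    · obtain ⟨y, hy⟩ : ∃ y, 16 = x + (y + 1) := ⟨15 - x, by omega⟩
      rw [ternaryNat_mul_add m x h, ← ha, ternaryBlock, hy, pow_add, mul_assoc,
        Nat.add_mul_div_left _ _ (by positivity), pow_succ, mul_comm (3 ^ y) 3, mul_assoc,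
        Nat.add_mul_mod_self_left]
    · obtain ⟨y, rfl⟩ := Nat.exists_eq_add_of_le h
      rw [pow_add, ← Nat.div_div_eq_div_mul, Nat.add_mul_div_left _ _ (by positivity),
        Nat.div_eq_of_lt (blockNumber_lt a (ha ▸ digitWord_lt m)), zero_add,
        ih (m + 1) ?_ y ?_]
      · congr 1; ring
      · intro i hi
        have := hl (i + 1) (Nat.succ_lt_succ hi)
        rw [List.getElem_cons_succ] at this
        rw [this]
        congr 1; ring
      · rw [List.length_cons] at hx
        omega

lemma mod_three_pow_eq {M N : ℕ} (E : ℕ) (h : ∀ j < E, M / 3 ^ j % 3 = N / 3 ^ j % 3) :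
    M % 3 ^ E = N % 3 ^ E := by
  induction E with
  | zero => simp [Nat.mod_one]
  | succ E ih =>
    rw [Nat.mod_pow_succ, Nat.mod_pow_succ, ih fun j hj => h j (by omega), h E (by omega)]

/-- Turns equality of factors into one equation between numbers, which keeps the finite checks
cheap. -/
lemma imageNumber_window {l l' : List ℕ} {m m' r r' E : ℕ}
    (hl : ∀ i (hi : i < l.length), l[i] = digitWord (m + i))
    (hl' : ∀ i (hi : i < l'.length), l'[i] = digitWord (m' + i))
    (hr : r + E ≤ 16 * l.length) (hr' : r' + E ≤ 16 * l'.length)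
    (h : ∀ j < E, ternaryNat (16 * m + (r + j)) = ternaryNat (16 * m' + (r' + j))) :
    imageNumber l / 3 ^ r % 3 ^ E = imageNumber l' / 3 ^ r' % 3 ^ E := by
  refine mod_three_pow_eq E fun j hj => ?_
  rw [Nat.div_div_eq_div_mul, Nat.div_div_eq_div_mul, ← pow_add, ← pow_add,
    imageNumber_digit l m hl _ (by omega), imageNumber_digit l' m' hl' _ (by omega), h j hj]

set_option synthInstance.maxHeartbeats 400000 in
set_option synthInstance.maxSize 1000 in
lemma imageNumber_separates : ∀ a < 7, ∀ d ∈ [1, 2], ∀ r < 16, ∀ b < 7, ∀ e ∈ [1, 2],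
    ∀ s < r, imageNumber [a, (a + d) % 7] / 3 ^ r % 3 ^ 16 ≠
      imageNumber [b, (b + e) % 7] / 3 ^ s % 3 ^ 16 := by
  decide +kernel

lemma ternaryNat_not_sync {n m : ℕ} (hlt : m % 16 < n % 16) :
    ¬ ∀ j < 16, ternaryNat (n + j) = ternaryNat (m + j) := by
  intro h
  obtain ⟨d, hd, hdn⟩ := exists_digitWord_succ (n / 16)
  obtain ⟨e, he, hem⟩ := exists_digitWord_succ (m / 16)
  have hr : n % 16 < 16 := Nat.mod_lt _ (by norm_num)
  refine imageNumber_separates _ (digitWord_lt (n / 16)) d hd _ hr _ (digitWord_lt (m / 16)) e he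
    (m % 16) hlt (imageNumber_window (m := n / 16) (m' := m / 16) ?_ ?_ ?_ ?_ ?_)
  · intro i hi
    simp only [List.length_cons, List.length_nil] at hi
    interval_cases i
    exacts [rfl, hdn.symm]
  · intro i hi
    simp only [List.length_cons, List.length_nil] at hi
    interval_cases i
    exacts [rfl, hem.symm]
  · simp only [List.length_cons, List.length_nil]; omega
  · simp only [List.length_cons, List.length_nil]; omega
  · intro j hj
    rw [← add_assoc, ← add_assoc, Nat.div_add_mod, Nat.div_add_mod, h j hj]

lemma ternaryNat_sync {n m : ℕ} (h : ∀ j < 16, ternaryNat (n + j) = ternaryNat (m + j)) :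
    n % 16 = m % 16 := by
  rcases lt_trichotomy (n % 16) (m % 16) with hlt | heq | hlt
  · exact absurd (fun j hj => (h j hj).symm) (ternaryNat_not_sync hlt)
  · exact heq
  · exact absurd h (ternaryNat_not_sync hlt)

set_option synthInstance.maxHeartbeats 400000 in
set_option synthInstance.maxSize 1000 in
-- Four blocks suffice: offset, period and overlap are at most 15, 30 and 15, within 64 digits.
lemma imageNumber_short : ∀ a < 7, ∀ d ∈ [1, 2], ∀ e ∈ [1, 2], ∀ f ∈ [1, 2],
    ∀ r < 16, ∀ P < 31, 3 ≤ P →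
    imageNumber [a, (a + d) % 7, (a + d + e) % 7, (a + d + e + f) % 7] / 3 ^ r
        % 3 ^ ((P + 1) / 2) ≠
      imageNumber [a, (a + d) % 7, (a + d + e) % 7, (a + d + e + f) % 7] / 3 ^ (r + P)
        % 3 ^ ((P + 1) / 2) := by
  decide +kernel

set_option synthInstance.maxHeartbeats 400000 in
set_option synthInstance.maxSize 1000 in
lemma imageNumber_two : ∀ a < 7, ∀ d ∈ [1, 2], ∀ r < 16,
    imageNumber [a, (a + d) % 7] / 3 ^ r % 3 = imageNumber [a, (a + d) % 7] / 3 ^ (r + 2) % 3 →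
      imageNumber [a, (a + d) % 7] / 3 ^ r % 3 <
        imageNumber [a, (a + d) % 7] / 3 ^ (r + 1) % 3 ∧
      imageNumber [a, (a + d) % 7] / 3 ^ (r + 1) % 3 ≠
        imageNumber [a, (a + d) % 7] / 3 ^ (r + 3) % 3 := by
  decide +kernel

lemma ternaryNat_no_long_repetition {n P E : ℕ} (hP : 1 ≤ P) (hE : 16 ≤ E) (hPE : P ≤ 2 * E) :
    ¬ HasRepetition ternaryNat n P E := by
  intro h
  have hs : n % 16 = (n + P) % 16 := ternaryNat_sync fun j hj => h j (by omega)
  obtain ⟨Q, rfl⟩ : 16 ∣ P := by omega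
  -- Counted are the blocks with their last 8 or first 6 letters in the overlap. At most 7 + 5 = 12
  -- letters are lost at the ends, which the `+ 1` in the seven-letter bound absorbs.
  refine digitWord_no_repetition (n := (n + 7) / 16) (P := Q)
    (E := (n + E + 10) / 16 - (n + 7) / 16) (by omega) (by omega) (by omega) ?_
  intro j hj
  set m := (n + 7) / 16 + j with hm
  have key : ∀ r < 16, n ≤ 16 * m + r → 16 * m + r < n + E →
      ternaryBlock (digitWord m) r = ternaryBlock (digitWord (m + Q)) r := by
    intro r hr h1 h2
    have := h (16 * m + r - n) (by omega)
    rwa [show n + (16 * m + r - n) = 16 * m + r by omega,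
      show n + 16 * Q + (16 * m + r - n) = 16 * (m + Q) + r by omega,
      ternaryNat_mul_add _ _ hr, ternaryNat_mul_add _ _ hr] at this
  rw [show (n + 7) / 16 + Q + j = m + Q by omega]
  rcases Nat.lt_or_ge (16 * m) n with hlt | hge
  · exact ternaryBlock_suffix _ (digitWord_lt _) _ (digitWord_lt _)
      fun r hr => key (8 + r) (by omega) (by omega) (by omega)
  · exact ternaryBlock_prefix _ (digitWord_lt _) _ (digitWord_lt _)
      fun r hr => key r (by omega) (by omega) (by omega)

lemma ternaryNat_no_short_repetition {n P E : ℕ} (hP : 3 ≤ P) (hP' : P < 31) (hPE : P ≤ 2 * E) :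
    ¬ HasRepetition ternaryNat n P E := by
  intro h
  obtain ⟨d, hd, hdn⟩ := exists_digitWord_succ (n / 16)
  obtain ⟨e, he, hen⟩ := exists_digitWord_succ (n / 16 + 1)
  obtain ⟨f, hf, hfn⟩ := exists_digitWord_succ (n / 16 + 1 + 1)
  have hr : n % 16 < 16 := Nat.mod_lt _ (by norm_num)
  have hl : ∀ i (hi : i < [digitWord (n / 16), (digitWord (n / 16) + d) % 7,
      (digitWord (n / 16) + d + e) % 7, (digitWord (n / 16) + d + e + f) % 7].length),
      [digitWord (n / 16), (digitWord (n / 16) + d) % 7,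
        (digitWord (n / 16) + d + e) % 7, (digitWord (n / 16) + d + e + f) % 7][i] =
        digitWord (n / 16 + i) := by
    intro i hi
    simp only [List.length_cons, List.length_nil] at hi
    have h2 : (digitWord (n / 16) + d + e) % 7 = digitWord (n / 16 + 1 + 1) := by omega
    have h3 : (digitWord (n / 16) + d + e + f) % 7 = digitWord (n / 16 + 1 + 1 + 1) := by omega
    interval_cases i
    exacts [rfl, hdn.symm, h2, h3]
  refine imageNumber_short _ (digitWord_lt (n / 16)) d hd e he f hf _ hr P hP' hP
    (imageNumber_window hl hl ?_ ?_ ?_)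
  · simp only [List.length_cons, List.length_nil]; omega
  · simp only [List.length_cons, List.length_nil]; omega
  · intro j hj
    have := h j (by omega)
    rwa [← Nat.div_add_mod n 16, add_assoc, add_assoc, add_assoc, ← add_assoc (n % 16) P] at this

theorem ternaryNat_repetition {n P E : ℕ} (hP : 2 ≤ P) (hPE : P ≤ 2 * E)
    (h : HasRepetition ternaryNat n P E) :
    P = 2 ∧ E = 1 ∧ ternaryNat n < ternaryNat (n + 1) := by
  rcases Nat.lt_or_ge E 16 with hE | hE
  swap
  · exact absurd h (ternaryNat_no_long_repetition (by omega) hE hPE)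
  rcases Nat.lt_or_ge 2 P with h2 | h2
  · exact absurd h (ternaryNat_no_short_repetition h2 (by omega) hPE)
  obtain rfl : P = 2 := by omega
  obtain ⟨d, hd, hdn⟩ := exists_digitWord_succ (n / 16)
  have hr : n % 16 < 16 := Nat.mod_lt _ (by norm_num)
  have b : ∀ k < 4, imageNumber [digitWord (n / 16), (digitWord (n / 16) + d) % 7] /
      3 ^ (n % 16 + k) % 3 = ternaryNat (n + k) := fun k hk => by
    rw [imageNumber_digit _ (n / 16) ?_ _ (by simp; omega), ← add_assoc, Nat.div_add_mod]
    intro i hi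
    simp only [List.length_cons, List.length_nil] at hi
    interval_cases i
    exacts [rfl, hdn.symm]
  have key := imageNumber_two _ (digitWord_lt (n / 16)) d hd (n % 16) hr
  rw [b 1 (by norm_num), b 2 (by norm_num), b 3 (by norm_num), ← add_zero (n % 16),
    b 0 (by norm_num)] at key
  obtain ⟨hlt, hne⟩ := key (h 0 (by omega))
  refine ⟨rfl, ?_, hlt⟩
  by_contra hE1
  exact hne (h 1 (by omega))

/-- The ternary word `ternaryNat`, with its letters in `Fin 3`. -/
def ternaryWord (n : ℕ) : Fin 3 := ⟨ternaryNat n, Nat.mod_lt _ (by norm_num)⟩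

theorem ternaryWord_repetition {n P E : ℕ} (hP : 2 ≤ P) (hPE : P ≤ 2 * E)
    (h : HasRepetition ternaryWord n P E) :
    P = 2 ∧ E = 1 ∧ ternaryWord n < ternaryWord (n + 1) :=
  ternaryNat_repetition hP hPE fun j hj => congrArg Fin.val (h j hj)

/-! ### Occurrences of circular formulas -/

/-- The finite word `u` occurs in the infinite word `w`. -/
def OccursIn {S : Type*} (u : List S) (w : ℕ → S) : Prop :=
  ∃ n, ∀ k (hk : k < u.length), u[k] = w (n + k)

lemma isFactorOf_iff {S : Type*} (u : FreeMonoid S) (w : ℕ → S) :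
    IsFactorOf u w ↔ OccursIn u.toList w := by
  refine exists_congr fun n => ⟨fun h k hk => ?_, fun h => ?_⟩
  · simp [h]
  · refine List.ext_getElem (by simp [FreeMonoid.length]) fun k h1 h2 => ?_
    simp [h k h1]

lemma OccursIn.of_infix {S : Type*} {u v : List S} {w : ℕ → S} (huv : u <:+: v)
    (hv : OccursIn v w) : OccursIn u w := by
  obtain ⟨s, t, rfl⟩ := huv
  obtain ⟨n, hn⟩ := hv
  refine ⟨n + s.length, fun k hk => ?_⟩
  have := hn (s.length + k) (by simp; omega)
  rw [add_assoc, ← this, List.getElem_append_left (by simp; omega),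
    List.getElem_append_right (by omega)]
  simp

lemma OccursIn.hasRepetition {S : Type*} {u v : List S} {w : ℕ → S}
    (h : OccursIn (u ++ (v ++ u)) w) :
    ∃ n, HasRepetition w n (u.length + v.length) u.length ∧
      (∀ k (hk : k < u.length), u[k] = w (n + k)) ∧
      ∀ k (hk : k < v.length), v[k] = w (n + u.length + k) := by
  obtain ⟨n, hn⟩ := h
  have hu : ∀ k (hk : k < u.length), u[k] = w (n + k) := fun k hk => by
    rw [← hn k (by simp; omega), List.getElem_append_left hk]
  refine ⟨n, fun j hj => ?_, hu, fun k hk => ?_⟩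
  · rw [← hu j hj, add_assoc, ← hn (u.length + v.length + j) (by simp; omega),
      List.getElem_append_right (by omega), List.getElem_append_right (by omega)]
    congr 1
    omega
  · rw [add_assoc, ← hn (u.length + k) (by simp; omega),
      List.getElem_append_right (by omega), List.getElem_append_left (by omega)]
    congr 1
    omega

lemma circularFormula_avoidedBy_iff {S : Type*} (i : ℕ) (w : ℕ → S) :
    (circularFormula i).AvoidedBy w ↔ ¬ ∃ X : ℕ → List S, (∀ j, X j ≠ []) ∧
      ∀ j < i, OccursIn (X j ++ (X ((j + 1) % i) ++ X j)) w := by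
  refine not_congr ⟨?_, ?_⟩
  · rintro ⟨h, hne, hf⟩
    refine ⟨fun j => (h (FreeMonoid.of j)).toList, fun j hj => hne j ?_, fun j hj => ?_⟩
    · exact FreeMonoid.toList.injective hj
    · have := (isFactorOf_iff _ _).1 (hf (FreeMonoid.ofList [j, (j + 1) % i, j])
        (List.mem_map.2 ⟨j, List.mem_range.2 hj, rfl⟩))
      have e : FreeMonoid.ofList [j, (j + 1) % i, j] =
        FreeMonoid.of j * (FreeMonoid.of ((j + 1) % i) * FreeMonoid.of j) := rfl
      rwa [e, MonoidHom.map_mul, MonoidHom.map_mul, FreeMonoid.toList_mul,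
        FreeMonoid.toList_mul] at this
  · rintro ⟨X, hne, hf⟩
    refine ⟨FreeMonoid.lift fun j => FreeMonoid.ofList (X j), fun j hj => hne j ?_, ?_⟩
    · rw [FreeMonoid.lift_eval_of] at hj
      exact FreeMonoid.ofList.injective hj
    · intro φ hφ
      obtain ⟨j, hj, rfl⟩ := List.mem_map.1 hφ
      have e : FreeMonoid.ofList [j, (j + 1) % i, j] =
        FreeMonoid.of j * (FreeMonoid.of ((j + 1) % i) * FreeMonoid.of j) := rfl
      rw [isFactorOf_iff, e, MonoidHom.map_mul, MonoidHom.map_mul, FreeMonoid.lift_eval_of,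
        FreeMonoid.lift_eval_of]
      exact hf j (List.mem_range.1 hj)

theorem circularFormula_avoidedBy_ternaryWord {i : ℕ} (hi : 0 < i) :
    (circularFormula i).AvoidedBy ternaryWord := by
  rw [circularFormula_avoidedBy_iff]
  rintro ⟨X, hne, hX⟩
  have hpos : ∀ j, 0 < (X j).length := fun j => List.length_pos_iff.2 (hne j)
  have hne' : (Finset.range i).Nonempty := ⟨0, Finset.mem_range.2 hi⟩
  have hmod : ∀ j, (j + 1) % i ∈ Finset.range i := fun j => Finset.mem_range.2 (Nat.mod_lt _ hi)
  obtain ⟨m, hm, hmax⟩ := Finset.exists_max_image (Finset.range i) (fun j => (X j).length) hne'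
  have hone : ∀ j < i, (X j).length = 1 := by
    obtain ⟨n, hn, -⟩ := (hX m (Finset.mem_range.1 hm)).hasRepetition
    have h1 := hpos m
    have h2 := hpos ((m + 1) % i)
    have h3 := hmax _ (hmod m)
    obtain ⟨-, hlen, -⟩ := ternaryWord_repetition (by omega) (by omega) hn
    intro j hj
    have h4 := hmax j (Finset.mem_range.2 hj)
    have h5 := hpos j
    omega
  have hlt : ∀ j < i, (X j)[0]'(hpos j) < (X ((j + 1) % i))[0]'(hpos _) := by
    intro j hj
    obtain ⟨n, hn, hu, hv⟩ := (hX j hj).hasRepetition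
    have h1 := hone j hj
    have h2 := hone _ (Finset.mem_range.1 (hmod j))
    obtain ⟨-, -, hlt⟩ := ternaryWord_repetition (by omega) (by omega) hn
    rw [hu 0 (hpos _), hv 0 (hpos _), h1]
    exact hlt
  obtain ⟨m, hm, hmax⟩ :=
    Finset.exists_max_image (Finset.range i) (fun j => (X j)[0]'(hpos j)) hne'
  exact absurd (hlt m (Finset.mem_range.1 hm)) (not_lt.2 (hmax _ (hmod m)))

/-! ### Binary words -/

/-- Five fragments that force occurrences of all circular formulas: a circuit of length two through
`A` and `B`, and one of length three through `A`, `C` and `D`. -/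
def circuitPair {S : Type*} (A B C D : List S) : List (List S) :=
  [A ++ (B ++ A), B ++ (A ++ B), A ++ (C ++ A), C ++ (D ++ C), D ++ (A ++ D)]

lemma not_avoidedBy_of_circuitPair {S : Type*} {w : ℕ → S} {A B C D : List S}
    (hA : A ≠ []) (hB : B ≠ []) (hC : C ≠ []) (hD : D ≠ [])
    (h : ∀ u ∈ circuitPair A B C D, OccursIn u w) {i : ℕ} (hi : 2 ≤ i) :
    ¬ (circularFormula i).AvoidedBy w := by
  simp only [circuitPair, List.forall_mem_cons, List.not_mem_nil, false_imp_iff, implies_true,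
    and_true] at h
  obtain ⟨hAB, hBA, hAC, hCD, hDA⟩ := h
  rw [circularFormula_avoidedBy_iff, not_not]
  rcases Nat.even_or_odd' i with ⟨k, rfl | rfl⟩
  · refine ⟨fun j => if j % 2 = 0 then A else B, fun j => by dsimp only; split_ifs <;> assumption,
      fun j hj => ?_⟩
    have h2 : (j + 1) % (2 * k) % 2 = (j + 1) % 2 := Nat.mod_mul_right_mod _ _ _
    dsimp only
    rw [h2]
    rcases Nat.mod_two_eq_zero_or_one j with h | h
    · rw [if_pos h, if_neg (by omega)]; exact hAB
    · rw [if_neg (by omega), if_pos (by omega)]; exact hBA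
  -- Odd length: once around A, C, D, then alternately A and B.
  · refine ⟨fun j => if j = 0 then A else if j = 1 then C else if j = 2 then D
      else if j % 2 = 1 then A else B,
      fun j => by dsimp only; split_ifs <;> assumption, fun j hj => ?_⟩
    dsimp only
    rcases Nat.lt_or_ge (j + 1) (2 * k + 1) with hlt | hge
    · rw [Nat.mod_eq_of_lt hlt]
      obtain rfl | rfl | rfl | h3 : j = 0 ∨ j = 1 ∨ j = 2 ∨ 3 ≤ j := by omega
      · simpa using hAC
      · simpa using hCD
      · simpa using hDA
      · rw [if_neg (by omega), if_neg (by omega), if_neg (by omega), if_neg (by omega : ¬ j + 1 = 0),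
          if_neg (by omega : ¬ j + 1 = 1), if_neg (by omega : ¬ j + 1 = 2)]
        rcases Nat.mod_two_eq_zero_or_one j with h | h
        · rw [if_neg (by omega), if_pos (by omega)]; exact hBA
        · rw [if_pos h, if_neg (by omega)]; exact hAB
    · obtain rfl : j = 2 * k := by omega
      rw [Nat.mod_self, if_pos rfl, if_neg (by omega), if_neg (by omega)]
      split_ifs with h1 h2
      · exact hDA
      · omega
      · exact hBA

/-- The word `u` contains all the words of some member of `L`. -/
def Covers (L : List (List (List (Fin 2)))) (u : List (Fin 2)) : Bool :=
  L.any fun c => c.all fun x => decide (x <:+: u)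

/-- Every binary word that extends `u` by `n` letters contains all the words of some member
of `L`. -/
def Unavoidable (L : List (List (List (Fin 2)))) : ℕ → List (Fin 2) → Bool
  | 0, u => Covers L u
  | n + 1, u => Covers L u || (Unavoidable L n (u ++ [0]) && Unavoidable L n (u ++ [1]))

lemma exists_of_covers {L : List (List (List (Fin 2)))} {u : List (Fin 2)} {w : ℕ → Fin 2}
    (hu : OccursIn u w) (h : Covers L u = true) : ∃ c ∈ L, ∀ x ∈ c, OccursIn x w := by
  simp only [Covers, List.any_eq_true, List.all_eq_true, decide_eq_true_eq] at h
  obtain ⟨c, hc, hx⟩ := h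
  exact ⟨c, hc, fun x hxc => hu.of_infix (hx x hxc)⟩

lemma exists_of_unavoidable {L : List (List (List (Fin 2)))} {w : ℕ → Fin 2} (n : ℕ) :
    ∀ {u : List (Fin 2)}, OccursIn u w → Unavoidable L n u = true →
      ∃ c ∈ L, ∀ x ∈ c, OccursIn x w := by
  induction n with
  | zero => exact fun hu h => exists_of_covers hu h
  | succ n ih =>
    rintro u ⟨m, hm⟩ h
    simp only [Unavoidable, Bool.or_eq_true, Bool.and_eq_true] at h
    rcases h with h | ⟨h0, h1⟩
    · exact exists_of_covers ⟨m, hm⟩ h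
    have key : OccursIn (u ++ [w (m + u.length)]) w := by
      refine ⟨m, fun k hk => ?_⟩
      rw [List.length_append, List.length_singleton] at hk
      rcases Nat.lt_or_ge k u.length with hlt | hge
      · rw [List.getElem_append_left hlt, hm k hlt]
      · obtain rfl : k = u.length := by omega
        simp
    rcases Fin.exists_fin_two.1 ⟨w (m + u.length), rfl⟩ with h | h
    · exact ih (h ▸ key) h0
    · exact ih (h ▸ key) h1

/-- Quadruples of binary words such that every infinite binary word contains the `circuitPair` of
one of them. -/
def binaryQuadruples : List (List (Fin 2) × List (Fin 2) × List (Fin 2) × List (Fin 2)) :=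
  [([1], [1], [1], [1]),
   ([0], [0], [0], [0]),
   ([1, 0], [1, 0], [1, 0], [1, 0]),
   ([0, 1], [0, 1], [0, 1], [0, 1]),
   ([0, 1, 0], [0, 1, 0], [0, 1, 0], [0, 1, 0]),
   ([0], [1], [1], [0, 1]),
   ([1, 0, 0], [1, 0, 0], [1, 0, 0], [1, 0, 0]),
   ([0], [1], [1, 0], [1]),
   ([0, 0, 1], [0, 0, 1], [0, 0, 1], [0, 0, 1]),
   ([1, 0, 1], [1, 0, 1], [1, 0, 1], [1, 0, 1]),
   ([0], [1], [0, 1], [1]),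
   ([0, 1, 1], [0, 1, 1], [0, 1, 1], [0, 1, 1]),
   ([0], [1], [1], [1, 0]),
   ([0, 1, 1, 0], [0, 1, 1, 0], [0, 1, 1, 0], [0, 1, 1, 0]),
   ([0], [1], [1, 0], [0, 1]),
   ([0], [1], [0, 1], [1, 0]),
   ([1, 0, 1, 1, 0], [1, 0, 1, 1, 0], [1, 0, 1, 1, 0], [1, 0, 1, 1, 0]),
   ([0, 0, 1, 0, 1], [0, 0, 1, 0, 1], [0, 0, 1, 0, 1], [0, 0, 1, 0, 1]),
   ([1, 0], [1], [1], [0, 1]),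
   ([0, 1], [0], [0], [1, 0])]

lemma binaryQuadruples_ne_nil : ∀ q ∈ binaryQuadruples,
    q.1 ≠ [] ∧ q.2.1 ≠ [] ∧ q.2.2.1 ≠ [] ∧ q.2.2.2 ≠ [] := by
  decide +kernel

lemma unavoidable_binaryQuadruples : Unavoidable
    (binaryQuadruples.map fun q => circuitPair q.1 q.2.1 q.2.2.1 q.2.2.2) 23 [] = true := by
  decide +kernel

theorem circularFormula_not_avoidable_two {i : ℕ} (hi : 2 ≤ i) :
    ¬ (circularFormula i).Avoidable 2 := by
  rintro ⟨w, hw⟩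
  obtain ⟨c, hc, hx⟩ := exists_of_unavoidable (w := w) 23 (u := [])
    ⟨0, fun k hk => absurd hk (Nat.not_lt_zero k)⟩ unavoidable_binaryQuadruples
  obtain ⟨q, hq, rfl⟩ := List.mem_map.1 hc
  obtain ⟨hA, hB, hC, hD⟩ := binaryQuadruples_ne_nil q hq
  exact not_avoidedBy_of_circuitPair hA hB hC hD hx hi hw

/-! ### The avoidability index -/

/-- Composing an occurrence with a letter-to-letter map gives an occurrence in the image word. -/
lemma Formula.AvoidedBy.of_comp {S T : Type*} {f : Formula} {w : ℕ → S} {e : S → T}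
    (h : f.AvoidedBy (e ∘ w)) : f.AvoidedBy w := by
  rintro ⟨g, hne, hf⟩
  refine h ⟨(FreeMonoid.map e).comp g, fun x hx => hne x ?_, fun φ hφ => ?_⟩
  · have := congrArg FreeMonoid.toList hx
    rw [MonoidHom.comp_apply, FreeMonoid.toList_map] at this
    exact FreeMonoid.toList.injective (List.map_eq_nil_iff.1 this)
  · obtain ⟨n, hn⟩ := (isFactorOf_iff _ _).1 (hf φ hφ)
    rw [isFactorOf_iff, MonoidHom.comp_apply, FreeMonoid.toList_map]
    refine ⟨n, fun k hk => ?_⟩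
    rw [List.getElem_map, hn k (by simpa using hk)]
    rfl

lemma Formula.Avoidable.mono {f : Formula} {k l : ℕ} (hkl : k ≤ l) (h : f.Avoidable k) :
    f.Avoidable l := by
  obtain ⟨w, hw⟩ := h
  have : Nonempty (Fin k) := ⟨w 0⟩
  refine ⟨Fin.castLE hkl ∘ w, Formula.AvoidedBy.of_comp
    (e := Function.invFun (Fin.castLE hkl)) ?_⟩
  rwa [← Function.comp_assoc, Function.invFun_comp (Fin.castLE_injective hkl),
    Function.id_comp]

theorem mainTheorem3 (i : ℕ) (hi : 2 ≤ i) :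
    (circularFormula i).avoidabilityIndex = 3 := by
  refine le_antisymm ?_ (le_iInf₂ fun k hk => ?_)
  · exact iInf₂_le 3 ⟨ternaryWord, circularFormula_avoidedBy_ternaryWord (by omega)⟩
  · by_contra hlt
    have hk2 : k ≤ 2 := by
      by_contra h3
      exact hlt (by exact_mod_cast (by omega : 3 ≤ k))
    exact circularFormula_not_avoidable_two hi (hk.mono hk2)
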